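/- Let $d,m\ge 0$ be integers, let $\mathcal D(\mathbb R^d)'$ be the space of complex-valued Schwartz distributions on $\mathbb R^d$, and for $y\in\mathbb R^d$ let $\tau_y$ be the shift operator on $\mathcal D(\mathbb R^d)'$ which extends $(\tau_y f)(x)=f(x+y)$ from functions to distributions, i.e. $\langle \tau_y f,\varphi\rangle=\langle f,\varphi(\cdot-y)\rangle$ for every test function $\varphi$. Let $f_1,\dots,f_m\in\mathcal D(\mathbb R^d)'$, let $c_1,\dots,c_m$ be real $d\times d$ matrices, and let $W$ be a finite-dimensional complex linear subspace of $\mathcal D(\mathbb R^d)'$ such that $$\sum_{i=1}^m\tau_{c_iy}(f_i)\in W\qquad\text{for all } y\in\mathbb R^d .$$ If all the matrices $c_i$ and all the matrices $c_i-c_j$ with $i\ne j$ are invertible, then every $f_i$ is a continuous exponential polynomial; that is, for each $i$ there are $N\ge 0$, polynomials $P_1,\dots,P_N\in\mathbb C[x_1,\dots,x_d]$ and vectors $a_1,\dots,a_N\in\mathbb C^d$ such that $f_i$ is the distribution given by integration against the continuous function $$x\mapsto\sum_{k=1}^N P_k(x)\,e^{\langle a_k,x\rangle},\qquad \langle a,x\rangle=\sum_{j=1}^d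 a_jx_j .$$ -/

import Mathlib

/-- `ℝ^d` with its Euclidean structure and Lebesgue measure. -/
abbrev Rd (d : ℕ) : Type := EuclideanSpace ℝ (Fin d)

/-- `𝒟(ℝ^d)`: the (real-valued) smooth compactly supported functions on `ℝ^d`, with Mathlib's
canonical LF topology. -/
abbrev TestFun (d : ℕ) : Type := TestFunction (⊤ : TopologicalSpace.Opens (Rd d)) ℝ ⊤

/-- `𝒟(ℝ^d)'`: the complex-valued Schwartz distributions on `ℝ^d`. Mathlib realises them as the
continuous real-linear maps from real-valued test functions to `ℂ`; these are the restrictions of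
the continuous complex-linear forms on complex-valued test functions. -/
abbrev SchwartzDistrib (d : ℕ) : Type := Distribution (⊤ : TopologicalSpace.Opens (Rd d)) ℂ ⊤

namespace TestFun

variable {d : ℕ}

/-- The test function `x ↦ φ (x + h)`. -/
noncomputable def shiftFun (h : Rd d) (φ : TestFun d) : TestFun d where
  toFun x := φ (x + h)
  contDiff' := φ.contDiff.comp (contDiff_id.add contDiff_const)
  hasCompactSupport' := φ.hasCompactSupport.comp_homeomorph (Homeomorph.addRight h)
  tsupport_subset' := fun _ _ => trivial

@[simp]
theorem shiftFun_apply (h : Rd d) (φ : TestFun d) (x : Rd d) : shiftFun h φ x = φ (x + h) := rfl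

open TopologicalSpace in
/-- The shift by `h` from smooth functions supported in `K` to smooth functions supported in
`K - h`. -/
noncomputable def shiftSupp (h : Rd d) (K : Compacts (Rd d)) (φ : ContDiffMapSupportedIn (Rd d) ℝ ⊤ K) :
    ContDiffMapSupportedIn (Rd d) ℝ ⊤
      (K.map (fun x => x - h) (continuous_id.sub continuous_const)) where
  toFun x := φ (x + h)
  contDiff' := φ.contDiff.comp (contDiff_id.add contDiff_const)
  zero_on_compl' := by
    intro x hx
    refine φ.zero_on_compl fun hK => hx ?_
    exact ⟨x + h, hK, by simp⟩

open TopologicalSpace in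
theorem continuous_shiftSupp (h : Rd d) (K : Compacts (Rd d)) : Continuous (shiftSupp h K) := by
  rw [ContDiffMapSupportedIn.continuous_iff_comp]
  intro i
  have key : (ContDiffMapSupportedIn.structureMapCLM ℝ ⊤ i ∘ shiftSupp h K) =
      (fun u => u.compContinuous ⟨fun x => x + h, continuous_id.add continuous_const⟩) ∘
        (ContDiffMapSupportedIn.structureMapCLM ℝ ⊤ i :
          ContDiffMapSupportedIn (Rd d) ℝ ⊤ K → _) := by
    funext φ
    ext1 x
    simp only [Function.comp_apply, ContDiffMapSupportedIn.structureMapCLM_top_apply,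
      BoundedContinuousFunction.compContinuous_apply, ContinuousMap.coe_mk]
    exact iteratedFDeriv_comp_add_right i h x
  rw [key]
  exact (BoundedContinuousFunction.continuous_compContinuous _).comp
    (ContinuousLinearMap.continuous _)

/-- The shift operator `φ ↦ (x ↦ φ (x + h))` on `𝒟(ℝ^d)`, as a continuous linear map. -/
noncomputable def shift (h : Rd d) : TestFun d →L[ℝ] TestFun d :=
  TestFunction.mkCLM ℝ (shiftFun h) (fun _ _ => rfl) (fun _ _ => rfl)
    (fun K _ => (TestFunction.continuous_ofSupportedIn (Set.subset_univ _)).comp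
      (continuous_shiftSupp h K))

@[simp]
theorem shift_apply (h : Rd d) (φ : TestFun d) (x : Rd d) : shift h φ x = φ (x + h) := rfl

end TestFun

namespace SchwartzDistrib

variable {d : ℕ}

/-- The shift operator `τ_y` on `𝒟(ℝ^d)'`, the transpose of the shift by `-y` on test functions:
`⟨τ_y T, φ⟩ = ⟨T, φ(· - y)⟩`. It extends `τ_y f (x) = f (x + y)` from functions to
distributions. -/
noncomputable def tau (y : Rd d) : SchwartzDistrib d →L[ℝ] SchwartzDistrib d :=
  (TestFun.shift (-y)).precompCompactConvergenceCLM ℂ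

theorem tau_apply (y : Rd d) (T : SchwartzDistrib d) (φ : TestFun d) :
    tau y T φ = T (TestFun.shift (-y) φ) := rfl

end SchwartzDistrib

/-- A function `g : ℝ^d → ℂ` is a (continuous) exponential polynomial if it is a finite sum
`g x = ∑ k, P k x * exp ⟨a k, x⟩`, where the `P k` are polynomials in `d` variables with complex
coefficients, `a k ∈ ℂ^d`, and `⟨a, x⟩ = ∑ j, a j * x j`. -/
def IsExpPoly {d : ℕ} (g : Rd d → ℂ) : Prop :=
  ∃ (N : ℕ) (P : Fin N → MvPolynomial (Fin d) ℂ) (a : Fin N → Fin d → ℂ), ∀ x : Rd d,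
    g x = ∑ k, MvPolynomial.eval (fun j => (x j : ℂ)) (P k) *
      Complex.exp (∑ j, a k j * (x j : ℂ))

/-- A distribution is a continuous exponential polynomial if it is given by integration against
a continuous function that is an exponential polynomial. -/
def SchwartzDistrib.IsContinuousExpPoly {d : ℕ} (T : SchwartzDistrib d) : Prop :=
  ∃ g : Rd d → ℂ, Continuous g ∧ IsExpPoly g ∧
    ∀ φ : TestFun d, T φ = ∫ x : Rd d, (φ x : ℂ) * g x

/-! The proof is an induction on the number of terms. Replacing y by y + h, shifting by -c_k h and
subtracting the original relation kills the k-th term and turns f_j into τ_{(c_j - c_k)h} f_j - f_j.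
Since c_i - c_k is invertible, every difference τ_y f_i - f_i then lies in a finite-dimensional
translation invariant space (`FiniteOrbit`). By `FiniteOrbit.of_forall_sub` so does f_i: finitely
many shifts generate a dense subgroup of ℝ^d, and finite-dimensional spaces are closed.

What remains is the Anselone–Korevaar theorem, `FiniteOrbit.isContinuousExpPoly`. Translations act
on the invariant space by a continuous representation a, so some average ∫ ρ(y) a(y) dy is
invertible and f = ∫ ρ(y) τ_y S dy for some S in the space. By `integral_tau_comm`, ρ and the test
function can be exchanged, so f is the function y ↦ ⟨τ_y S, ρ⟩. This is a matrix coefficient of a,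
hence an exponential polynomial by decomposition into generalized eigenvectors. -/

open MeasureTheory Topology TopologicalSpace Set Filter
open scoped BoundedContinuousFunction Convolution ContDiff

/-! ### Local structure of distributions and continuity of translation -/

/-- A linear map into `ℂ` which is bounded in terms of a linear map `j` into a normed space factors
through `j` by a continuous linear map. -/
theorem LinearMap.exists_clm_comp_eq_of_norm_le {V E : Type*} [AddCommGroup V] [Module ℝ V]
    [NormedAddCommGroup E] [NormedSpace ℝ E] (j : V →ₗ[ℝ] E) (u : V →ₗ[ℝ] ℂ) (C : ℝ)
    (h : ∀ v, ‖u v‖ ≤ C * ‖j v‖) : ∃ L : E →L[ℝ] ℂ, ∀ v, u v = L (j v) := by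
  obtain ⟨g, hg⟩ := j.rangeRestrict.exists_rightInverse_of_surjective (by simp)
  have hjg : ∀ x, j (g x) = x := fun x => congrArg Subtype.val (LinearMap.congr_fun hg x)
  let u' : LinearMap.range j →L[ℝ] ℂ := (u ∘ₗ g).mkContinuous C fun x => by
    simpa [hjg] using h (g x)
  -- The bound forces `u` to vanish on the kernel of `j`, so the choice of preimage `g` is harmless.
  have hu' : ∀ v, u' (j.rangeRestrict v) = u v := fun v => by
    have := h (g (j.rangeRestrict v) - v)
    rw [map_sub, map_sub, hjg] at this
    simpa [u', sub_eq_zero] using this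
  -- Hahn–Banach, applied to the real and imaginary parts separately.
  obtain ⟨r, hr, -⟩ := exists_extension_norm_eq (LinearMap.range j) (Complex.reCLM ∘L u')
  obtain ⟨i, hi, -⟩ := exists_extension_norm_eq (LinearMap.range j) (Complex.imCLM ∘L u')
  refine ⟨Complex.ofRealCLM ∘L r + Complex.I • (Complex.ofRealCLM ∘L i), fun v => ?_⟩
  have h1 := hr (j.rangeRestrict v)
  have h2 := hi (j.rangeRestrict v)
  simp only [ContinuousLinearMap.comp_apply, hu',
    Complex.reCLM_apply, Complex.imCLM_apply] at h1 h2
  change r (j v) = _ at h1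
  change i (j v) = _ at h2
  simp [h1, h2, mul_comm Complex.I, Complex.re_add_im]

/-- Finite families of bounded continuous functions, of the type of the derivatives of orders in `s`
of a function on `ℝ^d`. -/
def JetSpace (d : ℕ) (s : Finset ℕ) : Type := (i : s) → Rd d →ᵇ (Rd d [×(i : ℕ)]→L[ℝ] ℝ)

namespace JetSpace

variable {d : ℕ} {s : Finset ℕ}

noncomputable instance : NormedAddCommGroup (JetSpace d s) :=
  inferInstanceAs (NormedAddCommGroup ((i : s) → Rd d →ᵇ (Rd d [×(i : ℕ)]→L[ℝ] ℝ)))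

noncomputable instance : NormedSpace ℝ (JetSpace d s) :=
  inferInstanceAs (NormedSpace ℝ ((i : s) → Rd d →ᵇ (Rd d [×(i : ℕ)]→L[ℝ] ℝ)))

instance : CompleteSpace (JetSpace d s) :=
  inferInstanceAs (CompleteSpace ((i : s) → Rd d →ᵇ (Rd d [×(i : ℕ)]→L[ℝ] ℝ)))

theorem norm_apply_le (J : JetSpace d s) (i : s) : ‖J i‖ ≤ ‖J‖ :=
  norm_le_pi_norm (show (i : s) → Rd d →ᵇ (Rd d [×(i : ℕ)]→L[ℝ] ℝ) from J) i

/-- Evaluation of the `i`-th component at a point. -/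
noncomputable def eval (i : s) (x : Rd d) : JetSpace d s →L[ℝ] (Rd d [×(i : ℕ)]→L[ℝ] ℝ) :=
  LinearMap.mkContinuous
    { toFun := fun J => J i x
      map_add' := fun _ _ => rfl
      map_smul' := fun _ _ => rfl } 1 fun J => by
    rw [one_mul]
    exact ((J i).norm_coe_le_norm x).trans (J.norm_apply_le i)

theorem eval_apply (i : s) (x : Rd d) (J : JetSpace d s) : eval i x J = J i x := rfl

end JetSpace

namespace TestFun

variable {d : ℕ}

/-- The `i`-th derivative of a test function, as a bounded continuous function. -/
noncomputable def jet (φ : TestFun d) (i : ℕ) : Rd d →ᵇ (Rd d [×i]→L[ℝ] ℝ) :=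
  ContDiffMapSupportedIn.structureMapCLM ℝ ⊤ i
    (ContDiffMapSupportedIn.of_support_subset (K := ⟨tsupport φ, φ.hasCompactSupport⟩)
      φ.contDiff (subset_tsupport φ))

theorem jet_apply (φ : TestFun d) (i : ℕ) (x : Rd d) : jet φ i x = iteratedFDeriv ℝ i φ x := by
  rw [jet, ContDiffMapSupportedIn.structureMapCLM_top_apply]
  rfl

theorem jet_shift_apply (φ : TestFun d) (i : ℕ) (y x : Rd d) :
    jet (shift y φ) i x = jet φ i (x + y) := by
  rw [jet_apply, jet_apply]
  exact iteratedFDeriv_comp_add_right i y x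

theorem continuous_jet_shift (φ : TestFun d) (i : ℕ) :
    Continuous fun y : Rd d => jet (shift y φ) i := by
  have huc : UniformContinuous (jet φ i) := by
    refine Continuous.uniformContinuous_of_tendsto_cocompact (x := 0) (jet φ i).continuous ?_
    have : HasCompactSupport (jet φ i) := by
      have h := φ.hasCompactSupport.iteratedFDeriv (𝕜 := ℝ) i
      rwa [← show ⇑(jet φ i) = iteratedFDeriv ℝ i φ from funext (jet_apply φ i)] at h
    exact this.is_zero_at_infty
  rw [Metric.continuous_iff]
  intro y ε hε
  obtain ⟨δ, hδ, h⟩ := Metric.uniformContinuous_iff.1 huc (ε / 2) (by positivity)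
  refine ⟨δ, hδ, fun z hz => lt_of_le_of_lt ?_ (half_lt_self hε)⟩
  rw [BoundedContinuousFunction.dist_le (by positivity)]
  intro x
  rw [jet_shift_apply, jet_shift_apply]
  exact (h (by simpa using hz)).le

/-- The derivatives of orders in `s` of a test function. -/
noncomputable def jets (s : Finset ℕ) (φ : TestFun d) : JetSpace d s := fun i => jet φ i

theorem continuous_jets_shift (s : Finset ℕ) (φ : TestFun d) :
    Continuous fun y : Rd d => jets s (shift (-y) φ) :=
  continuous_pi fun i : s => (continuous_jet_shift φ i).comp continuous_neg

end TestFun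

namespace SchwartzDistrib

variable {d : ℕ}

open TestFun

/-- On test functions supported in a fixed compact set, a distribution is a continuous function of
finitely many derivatives. -/
theorem exists_eq_clm_jet (S : SchwartzDistrib d) (K : Compacts (Rd d)) :
    ∃ (s : Finset ℕ) (L : JetSpace d s →L[ℝ] ℂ),
      ∀ φ : TestFun d, Function.support φ ⊆ K → S φ = L (jets s φ) := by
  let T : ContDiffMapSupportedIn (Rd d) ℝ ⊤ K →L[ℝ] ℂ :=
    ContinuousLinearMap.comp (show TestFun d →L[ℝ] ℂ from S)
      (TestFunction.ofSupportedInCLM ℝ (subset_univ _))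
  obtain ⟨s, C, -, hC⟩ := Seminorm.bound_of_continuous
    (ContDiffMapSupportedIn.withSeminorms ℝ (Rd d) ℝ ⊤ K)
    ((normSeminorm ℝ ℂ).comp T.toLinearMap) (continuous_norm.comp T.continuous)
  let j : ContDiffMapSupportedIn (Rd d) ℝ ⊤ K →ₗ[ℝ] JetSpace d s :=
    { toFun := fun ψ i => ContDiffMapSupportedIn.structureMapCLM ℝ ⊤ (i : ℕ) ψ
      map_add' := fun _ _ => funext fun i =>
        map_add (ContDiffMapSupportedIn.structureMapCLM ℝ ⊤ (i : ℕ)) _ _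
      map_smul' := fun _ _ => funext fun i =>
        map_smul (ContDiffMapSupportedIn.structureMapCLM ℝ ⊤ (i : ℕ)) _ _ }
  obtain ⟨L, hL⟩ := LinearMap.exists_clm_comp_eq_of_norm_le j T.toLinearMap C fun ψ => by
    refine (hC ψ).trans ?_
    change (C : ℝ) * _ ≤ _
    gcongr
    refine Seminorm.finset_sup_apply_le (norm_nonneg _) fun i hi => ?_
    exact JetSpace.norm_apply_le (j ψ) ⟨i, hi⟩
  refine ⟨s, L, fun φ hφ => ?_⟩
  have h := hL (ContDiffMapSupportedIn.of_support_subset φ.contDiff hφ)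
  refine Eq.trans ?_ (h.trans ?_)
  · rfl
  · congr 1

theorem support_shift_subset (φ : TestFun d) {K : Set (Rd d)} {y : Rd d} (hy : y ∈ K) :
    Function.support (shift (-y) φ) ⊆ (fun p : Rd d × Rd d => p.1 + p.2) '' (tsupport φ ×ˢ K) := by
  intro x hx
  exact ⟨(x + -y, y), ⟨subset_tsupport φ hx, hy⟩, by simp⟩

/-- A single `L` must serve both the translates of `φ` by points of `K` and, later, their averages;
all of them are supported in the compact set `tsupport φ + K`. -/
theorem exists_tau_eq_clm_jet (S : SchwartzDistrib d) (φ : TestFun d) {K : Set (Rd d)}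
    (hK : IsCompact K) :
    ∃ (s : Finset ℕ) (L : JetSpace d s →L[ℝ] ℂ),
      (∀ y ∈ K, tau y S φ = L (jets s (shift (-y) φ))) ∧
      ∀ ψ : TestFun d, Function.support ψ ⊆
        (fun p : Rd d × Rd d => p.1 + p.2) '' (tsupport φ ×ˢ K) → S ψ = L (jets s ψ) := by
  obtain ⟨s, L, hL⟩ := exists_eq_clm_jet S
    ⟨_, (φ.hasCompactSupport.isCompact.prod hK).image continuous_add⟩
  exact ⟨s, L, fun y hy => hL _ (support_shift_subset φ hy), hL⟩

theorem continuous_tau_apply (S : SchwartzDistrib d) (φ : TestFun d) :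
    Continuous fun y : Rd d => tau y S φ := by
  rw [continuous_iff_continuousAt]
  intro y
  obtain ⟨s, L, hL, -⟩ := exists_tau_eq_clm_jet S φ (isCompact_closedBall y 1)
  have : Continuous fun y : Rd d => L (jets s (shift (-y) φ)) :=
    L.continuous.comp (continuous_jets_shift s φ)
  refine this.continuousAt.congr ?_
  filter_upwards [Metric.closedBall_mem_nhds y one_pos] with z hz using (hL z hz).symm

end SchwartzDistrib

/-! ### Regularization by convolution -/

section Convolution

variable {G F : Type*} [NormedAddCommGroup G] [NormedSpace ℝ G] [MeasurableSpace G] [BorelSpace G]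
  {μ : Measure G} [SFinite μ] [μ.IsAddLeftInvariant] [NormedAddCommGroup F] [NormedSpace ℝ F]
  {ρ : G → ℝ}

theorem fderiv_integral_smul_sub_apply {g : G → F} (hρ : LocallyIntegrable ρ μ)
    (hgc : HasCompactSupport g) (hg : ContDiff ℝ 1 g) (x v : G) :
    Integrable (fun y => ρ y • fderiv ℝ g (x - y) v) μ ∧
      fderiv ℝ (fun x => ∫ y, ρ y • g (x - y) ∂μ) x v = ∫ y, ρ y • fderiv ℝ g (x - y) v ∂μ := by
  have hint : Integrable (fun y => ρ y • fderiv ℝ g (x - y)) μ :=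
    (hgc.fderiv (𝕜 := ℝ)).convolutionExists_right
      (ContinuousLinearMap.lsmul ℝ ℝ) hρ (hg.continuous_fderiv one_ne_zero) x
  have hD : HasFDerivAt (fun x => ∫ y, ρ y • g (x - y) ∂μ) (∫ y, ρ y • fderiv ℝ g (x - y) ∂μ) x :=
    hgc.hasFDerivAt_convolution_right (ContinuousLinearMap.lsmul ℝ ℝ) hρ hg x
  refine ⟨hint.apply_continuousLinearMap v, ?_⟩
  rw [hD.fderiv]
  exact ContinuousLinearMap.integral_apply hint v

/-- Derivatives of a convolution with a smooth compactly supported function. -/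
theorem iteratedFDeriv_convolution_right {φ : G → ℝ} (hρ : LocallyIntegrable ρ μ)
    (hφc : HasCompactSupport φ) (hφ : ContDiff ℝ ∞ φ) (i : ℕ) (x : G) :
    iteratedFDeriv ℝ i (ρ ⋆[ContinuousLinearMap.lsmul ℝ ℝ, μ] φ) x =
      ∫ y, ρ y • iteratedFDeriv ℝ i φ (x - y) ∂μ := by
  have hint : ∀ i x, Integrable (fun y => ρ y • iteratedFDeriv ℝ i φ (x - y)) μ := fun i x =>
    (hφc.iteratedFDeriv (𝕜 := ℝ) i).convolutionExists_right
      (ContinuousLinearMap.lsmul ℝ ℝ) hρ (hφ.continuous_iteratedFDeriv (by exact_mod_cast le_top)) x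
  induction i generalizing x with
  | zero =>
    ext v
    exact (ContinuousMultilinearMap.apply ℝ (fun _ : Fin 0 => G) ℝ v).integral_comp_comm
      (hint 0 x)
  | succ i ih =>
    ext v
    obtain ⟨h1, h2⟩ := fderiv_integral_smul_sub_apply hρ (hφc.iteratedFDeriv (𝕜 := ℝ) i)
      (hφ.iteratedFDeriv_right (m := 1) (by exact_mod_cast le_top)) x (v 0)
    rw [iteratedFDeriv_succ_apply_left, funext ih, h2]
    refine ((ContinuousMultilinearMap.apply ℝ (fun _ : Fin i => G) ℝ
      (Fin.tail v)).integral_comp_comm h1).symm.trans (Eq.trans ?_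
      ((ContinuousMultilinearMap.apply ℝ (fun _ : Fin (i + 1) => G) ℝ v).integral_comp_comm
        (hint (i + 1) x)))
    rfl

end Convolution

namespace SchwartzDistrib

variable {d : ℕ}

open TestFun

/-- The convolution of two test functions. -/
noncomputable def _root_.TestFun.conv (ρ φ : TestFun d) : TestFun d where
  toFun := ρ ⋆[ContinuousLinearMap.lsmul ℝ ℝ] φ
  contDiff' := φ.hasCompactSupport.contDiff_convolution_right _
    ρ.continuous.locallyIntegrable φ.contDiff
  hasCompactSupport' := ρ.hasCompactSupport.convolution _ φ.hasCompactSupport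
  tsupport_subset' := fun _ _ => trivial

/-- On the relevant compact set `S` is a continuous functional of jets, so it commutes with the
Bochner integral in the Banach space `JetSpace`; that integral is the jet of the convolution. -/
theorem integral_smul_tau (S : SchwartzDistrib d) (ρ φ : TestFun d) :
    ∫ y, (ρ y : ℂ) * tau y S φ = S (TestFun.conv ρ φ) := by
  obtain ⟨s, L, hL, hL'⟩ := exists_tau_eq_clm_jet S φ ρ.hasCompactSupport.isCompact
  have hint : Integrable fun y => ρ y • jets s (shift (-y) φ) :=
    (ρ.continuous.smul (continuous_jets_shift s φ)).integrable_of_hasCompactSupport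
      ρ.hasCompactSupport.smul_right
  have h1 : ∀ y, (ρ y : ℂ) * tau y S φ = L (ρ y • jets s (shift (-y) φ)) := fun y => by
    by_cases hy : y ∈ tsupport ρ
    · rw [hL y hy, map_smul, Complex.real_smul]
    · simp [image_eq_zero_of_notMem_tsupport hy]
  simp_rw [h1]
  rw [L.integral_comp_comm hint, hL']
  · congr 1
    funext i
    ext1 x
    refine ((JetSpace.eval i x).integral_comp_comm hint).symm.trans ?_
    refine Eq.trans ?_ (iteratedFDeriv_convolution_right ρ.continuous.locallyIntegrable
      φ.hasCompactSupport φ.contDiff i x).symm |>.trans (jet_apply (ρ.conv φ) i x).symm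
    congr 1
    funext y
    rw [map_smul, JetSpace.eval_apply, jets, jet_shift_apply, jet_apply, ← sub_eq_add_neg]
  · intro x hx
    obtain ⟨y, hy, z, hz, rfl⟩ := support_convolution_subset _ hx
    exact ⟨(z, y), ⟨subset_tsupport _ hz, subset_tsupport _ hy⟩, add_comm _ _⟩

/-- Two ways of regularizing a distribution agree. -/
theorem integral_tau_comm (S : SchwartzDistrib d) (ρ φ : TestFun d) :
    ∫ y, (ρ y : ℂ) * tau y S φ = ∫ y, (φ y : ℂ) * tau y S ρ := by
  rw [integral_smul_tau, integral_smul_tau]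
  congr 1
  ext x
  refine (convolution_lsmul_swap (𝕜 := ℝ) (f := ρ) (g := φ) (x := x)).trans ?_
  change _ = ∫ y, φ y • ρ (x - y)
  simp only [smul_eq_mul, mul_comm]

end SchwartzDistrib

/-! ### One-parameter groups of operators -/

/-- A continuous one-parameter semigroup in a Banach algebra that is defined on all of `ℝ` is
differentiable. -/
theorem exists_hasDerivAt_of_map_add_eq_mul {𝔸 : Type*} [NormedRing 𝔸] [NormedAlgebra ℝ 𝔸]
    [CompleteSpace 𝔸] {b : ℝ → 𝔸} (hb : Continuous b) (h0 : b 0 = 1)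
    (hadd : ∀ s t, b (s + t) = b s * b t) : ∃ A : 𝔸, ∀ t, HasDerivAt b (b t * A) t := by
  let F : ℝ → 𝔸 := fun t => ∫ s in (0 : ℝ)..t, b s
  have hF : ∀ t, HasDerivAt F (b t) t := fun t => hb.integral_hasStrictDerivAt 0 t |>.hasDerivAt
  -- `F h / h` tends to `b 0 = 1` and the units are open.
  obtain ⟨h, hh, hu⟩ : ∃ h : ℝ, h ≠ 0 ∧ IsUnit (F h) := by
    have h1 : Tendsto (slope F 0) (𝓝[≠] 0) (𝓝 1) := by
      simpa [h0] using hasDerivAt_iff_tendsto_slope.1 (hF 0)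
    have h2 := h1.eventually (Units.isOpen.mem_nhds (isUnit_one : IsUnit (1 : 𝔸)))
    obtain ⟨h, hh, hne⟩ := (h2.and self_mem_nhdsWithin).exists
    refine ⟨h, hne, ?_⟩
    have h3 : slope F 0 h = h⁻¹ • F h := by simp [slope, F]
    have h4 : F h = algebraMap ℝ 𝔸 h * slope F 0 h := by
      rw [h3, ← Algebra.smul_def, smul_smul, mul_inv_cancel₀ hne, one_smul]
    rw [h4]
    exact ((isUnit_iff_ne_zero.2 hne).map (algebraMap ℝ 𝔸)).mul hh
  obtain ⟨u, hu⟩ := hu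
  -- This expresses `b` through its primitive `F`, so continuity of `b` upgrades to
  -- differentiability.
  have key : ∀ t, b t = (F (t + h) - F t) * (↑u⁻¹ : 𝔸) := fun t => by
    have : b t * F h = F (t + h) - F t := by
      simp only [F]
      rw [intervalIntegral.integral_interval_sub_left (hb.intervalIntegrable _ _)
        (hb.intervalIntegrable _ _)]
      refine ((ContinuousLinearMap.mul ℝ 𝔸 (b t)).intervalIntegral_comp_comm
        (hb.intervalIntegrable 0 h)).symm.trans ?_
      simp [← hadd]
    rw [← this, ← hu, mul_assoc, Units.mul_inv, mul_one]
  refine ⟨(b h - 1) * (↑u⁻¹ : 𝔸), fun t => ?_⟩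
  have h1 : HasDerivAt (fun t => (F (t + h) - F t) * (↑u⁻¹ : 𝔸)) ((b (t + h) - b t) * ↑u⁻¹) t :=
    (((hF (t + h)).comp_add_const t h).sub (hF t)).mul_const _
  rw [← funext key, hadd, ← mul_sub_one, mul_assoc] at h1
  exact h1

section OneParameter

variable {E : Type*} [NormedAddCommGroup E] [NormedSpace ℂ E]

/-- A one-parameter group acts on a generalized eigenvector of its generator by an exponential
polynomial. -/
theorem apply_eq_sum_of_pow_sub_apply_eq_zero {b : ℝ → E →L[ℂ] E} (h0 : b 0 = 1)
    (hadd : ∀ s t, b (s + t) = b s * b t) {A : E →L[ℂ] E} (hA : ∀ t, HasDerivAt b (b t * A) t)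
    {μ : ℂ} {k : ℕ} {v : E} (hv : ((A - μ • 1) ^ k) v = 0) (t : ℝ) :
    b t v = ∑ i ∈ Finset.range (k + 1),
      (Complex.exp (μ * t) * ((t : ℂ) ^ i / (i.factorial : ℂ))) • ((A - μ • 1) ^ i) v := by
  set N := A - μ • (1 : E →L[ℂ] E) with hN
  let u : ℝ → E := fun t => ∑ i ∈ Finset.range (k + 1), ((t : ℂ) ^ i / (i.factorial : ℂ)) • (N ^ i) v
  let w : ℝ → E := fun t => Complex.exp (μ * t) • u t
  have hu : ∀ t, HasDerivAt u (N (u t)) t := fun t => by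
    have h1 : HasDerivAt u (∑ i ∈ Finset.range (k + 1),
        (((i : ℂ) * (t : ℂ) ^ (i - 1)) / (i.factorial : ℂ)) • (N ^ i) v) t :=
      HasDerivAt.fun_sum fun i _ => by
        have := ((hasDerivAt_pow i (t : ℂ)).comp_ofReal.div_const (i.factorial : ℂ)).smul_const
          ((N ^ i) v)
        exact this
    convert h1 using 1
    simp only [u]
    -- The top term of `N (u t)` vanishes by `hv` and the constant term of `u` has zero derivative;
    -- the rest match after an index shift.
    rw [map_sum, Finset.sum_range_succ, Finset.sum_range_succ', map_smul,
      ← mul_apply_eq_comp, ← pow_succ', pow_succ' N k, mul_apply_eq_comp, hv]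
    simp only [map_zero, smul_zero, add_zero, Nat.cast_zero, zero_mul, zero_div, zero_smul]
    refine Finset.sum_congr rfl fun i _ => ?_
    rw [map_smul, ← mul_apply_eq_comp, ← pow_succ']
    congr 1
    rw [Nat.factorial_succ, Nat.add_sub_cancel]
    push_cast
    have : (i : ℂ) + 1 ≠ 0 := by exact_mod_cast Nat.succ_ne_zero i
    have : (i.factorial : ℂ) ≠ 0 := by exact_mod_cast i.factorial_ne_zero
    field_simp
  have hw : ∀ t, HasDerivAt w (A (w t)) t := fun t => by
    have he : HasDerivAt (fun t : ℝ => Complex.exp (μ * t)) (Complex.exp (μ * t) * μ) t := by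
      have h1 : HasDerivAt (fun z : ℂ => μ * z) μ (t : ℂ) := by
        simpa using (hasDerivAt_id (t : ℂ)).const_mul μ
      exact h1.cexp.comp_ofReal
    refine (he.smul (hu t)).congr_deriv ?_
    have hAN : ∀ e, A e = N e + μ • e := fun e => by simp [hN]
    simp only [w]
    rw [hAN, map_smul]
    module
  -- Uniqueness for the linear equation `w' = A w`: the two terms in the derivative of `b (-t) (w
  -- t)` cancel.
  have hconst : ∀ t, b (-t) (w t) = w 0 := by
    have hd : ∀ t, HasDerivAt (fun t => b (-t) (w t)) 0 t := fun t => by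
      have h1 := (ContinuousLinearMap.restrictScalarsL ℂ E E ℝ ℝ).hasFDerivAt.comp_hasDerivAt t
        ((hA (-t)).scomp t (hasDerivAt_neg t))
      have h2 := h1.clm_apply (hw t)
      simpa using h2
    intro t
    have := is_const_of_deriv_eq_zero (fun t => (hd t).differentiableAt) (fun t => (hd t).deriv) t 0
    simpa [h0] using this
  have hw0 : w 0 = v := by
    simp only [w, u]
    rw [Finset.sum_range_succ']
    simp
  have hinv : b t (b (-t) (w t)) = w t := by
    rw [← mul_apply_eq_comp, ← hadd, add_neg_cancel, h0, one_apply_eq_self]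
  rw [hconst, hw0] at hinv
  rw [hinv]
  simp only [w, u, Finset.smul_sum, smul_smul]

end OneParameter

/-! ### The algebra of exponential polynomials -/

namespace IsExpPoly

variable {d : ℕ}

theorem of_fintype {ι : Type*} [Fintype ι] {g : Rd d → ℂ} (P : ι → MvPolynomial (Fin d) ℂ)
    (a : ι → Fin d → ℂ) (h : ∀ x : Rd d, g x = ∑ k, MvPolynomial.eval (fun j => (x j : ℂ)) (P k) *
      Complex.exp (∑ j, a k j * (x j : ℂ))) : IsExpPoly g := by
  refine ⟨Fintype.card ι, fun k => P ((Fintype.equivFin ι).symm k),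
    fun k => a ((Fintype.equivFin ι).symm k), fun x => (h x).trans ?_⟩
  exact ((Fintype.equivFin ι).symm.sum_comp fun k => MvPolynomial.eval (fun j => (x j : ℂ)) (P k) *
      Complex.exp (∑ j, a k j * (x j : ℂ))).symm

theorem polynomial_mul_exp (P : MvPolynomial (Fin d) ℂ) (a : Fin d → ℂ) :
    IsExpPoly fun x : Rd d => MvPolynomial.eval (fun j => (x j : ℂ)) P *
      Complex.exp (∑ j, a j * (x j : ℂ)) :=
  of_fintype (fun _ : Unit => P) (fun _ => a) fun x => by simp

theorem zero : IsExpPoly fun _ : Rd d => 0 :=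
  of_fintype (ι := Empty) (fun k => k.elim) (fun k => k.elim) fun x => by simp

theorem const (c : ℂ) : IsExpPoly fun _ : Rd d => c := by
  simpa using polynomial_mul_exp (d := d) (MvPolynomial.C c) 0

theorem add {f g : Rd d → ℂ} (hf : IsExpPoly f) (hg : IsExpPoly g) :
    IsExpPoly fun x => f x + g x := by
  obtain ⟨N, P, a, hf⟩ := hf
  obtain ⟨M, Q, b, hg⟩ := hg
  refine of_fintype (Sum.elim P Q) (Sum.elim a b) fun x => ?_
  simp [hf, hg, Fintype.sum_sum_type]

theorem mul {f g : Rd d → ℂ} (hf : IsExpPoly f) (hg : IsExpPoly g) :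
    IsExpPoly fun x => f x * g x := by
  obtain ⟨N, P, a, hf⟩ := hf
  obtain ⟨M, Q, b, hg⟩ := hg
  refine of_fintype (fun k : Fin N × Fin M => P k.1 * Q k.2) (fun k => a k.1 + b k.2) fun x => ?_
  rw [hf, hg, Finset.sum_mul_sum, Fintype.sum_prod_type]
  refine Finset.sum_congr rfl fun k _ => Finset.sum_congr rfl fun l _ => ?_
  simp only [map_mul, Pi.add_apply, add_mul, Finset.sum_add_distrib, Complex.exp_add]
  ring

theorem sum {ι : Type*} (s : Finset ι) {f : ι → Rd d → ℂ} (hf : ∀ i ∈ s, IsExpPoly (f i)) :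
    IsExpPoly fun x => ∑ i ∈ s, f i x := by
  classical
  induction s using Finset.induction_on with
  | empty => simpa using zero
  | insert i s hi ih =>
    simp_rw [Finset.sum_insert hi]
    exact (hf i (by simp)).add (ih fun k hk => hf k (by simp [hk]))

theorem continuous {g : Rd d → ℂ} (hg : IsExpPoly g) : Continuous g := by
  obtain ⟨N, P, a, hg⟩ := hg
  rw [funext hg]
  have h : Continuous fun x : Rd d => fun j => (x j : ℂ) :=
    continuous_pi fun j => Complex.continuous_ofReal.comp (by fun_prop)
  refine continuous_finsetSum _ fun k _ => ?_
  refine ((MvPolynomial.continuous_eval (P k)).comp h).mul (Complex.continuous_exp.comp ?_)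
  exact continuous_finsetSum _ fun j _ => continuous_const.mul ((continuous_apply j).comp h)

end IsExpPoly

/-! ### Matrix coefficients of representations of ℝ^d -/

section Representation

variable {d : ℕ} {E : Type*} [NormedAddCommGroup E] [NormedSpace ℂ E] [FiniteDimensional ℂ E]

theorem isExpPoly_of_one_parameter_group {b : ℝ → E →L[ℂ] E} (hb : Continuous b) (h0 : b 0 = 1)
    (hadd : ∀ s t, b (s + t) = b s * b t) (l : E →ₗ[ℂ] ℂ) (v : E) (j : Fin d) :
    IsExpPoly fun x : Rd d => l (b (x j) v) := by
  have : CompleteSpace E := FiniteDimensional.complete ℂ E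
  obtain ⟨A, hA⟩ := exists_hasDerivAt_of_map_add_eq_mul hb h0 hadd
  have hv : v ∈ ⨆ μ : ℂ, Module.End.maxGenEigenspace (A : Module.End ℂ E) μ := by
    rw [Module.End.iSup_maxGenEigenspace_eq_top]; trivial
  induction hv using Submodule.iSup_induction' with
  | mem μ v hv =>
    obtain ⟨k, hk⟩ := (Module.End.mem_maxGenEigenspace _ _ _).1 hv
    have hk' : ((A - μ • 1) ^ k) v = 0 := by
      rw [← hk]
      have : ∀ n : ℕ, (((A - μ • 1) ^ n : E →L[ℂ] E) : E →ₗ[ℂ] E) =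
          ((A : Module.End ℂ E) - μ • 1) ^ n := fun n => by
        induction n with
        | zero => rfl
        | succ n ih => rw [pow_succ, pow_succ, ← ih]; rfl
      exact LinearMap.congr_fun (this k) v
    have h1 : ∀ x : Rd d, l (b (x j) v) = ∑ i ∈ Finset.range (k + 1),
        MvPolynomial.eval (fun j => (x j : ℂ)) (MvPolynomial.C
          (l (((A - μ • 1) ^ i) v) / (i.factorial : ℂ)) * MvPolynomial.X j ^ i) *
        Complex.exp (∑ j', (Pi.single j μ : Fin d → ℂ) j' * (x j' : ℂ)) := fun x => by
      rw [apply_eq_sum_of_pow_sub_apply_eq_zero h0 hadd hA hk', map_sum]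
      refine Finset.sum_congr rfl fun i _ => ?_
      simp only [map_smul, smul_eq_mul, map_mul, MvPolynomial.eval_C, map_pow, MvPolynomial.eval_X,
        Pi.single_apply, ite_mul, zero_mul, Finset.sum_ite_eq', Finset.mem_univ, if_true]
      ring
    simp_rw [h1]
    exact .sum _ fun i _ => .polynomial_mul_exp _ _
  | zero => simpa using IsExpPoly.zero
  | add v w _ _ hv hw => simpa using hv.add hw

/-- The matrix coefficients of a continuous finite-dimensional representation of `ℝ^d` are
exponential polynomials. -/
theorem isExpPoly_of_representation {a : Rd d → E →L[ℂ] E} (ha : Continuous a) (h0 : a 0 = 1)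
    (hadd : ∀ x y, a (x + y) = a x * a y) (l : E →ₗ[ℂ] ℂ) (v : E) :
    IsExpPoly fun x : Rd d => l (a x v) := by
  have key : ∀ (s : Finset (Fin d)) (l : E →ₗ[ℂ] ℂ),
      IsExpPoly fun x : Rd d => l (a (∑ j ∈ s, x j • EuclideanSpace.single j (1 : ℝ)) v) := by
    intro s
    induction s using Finset.induction_on with
    | empty => intro l; simpa using IsExpPoly.const _
    | insert j s hj ih =>
      intro l
      -- Inserting a basis between the two commuting factors splits the coefficient into a sum of
      -- products, one factor depending on `x j` alone.
      let β := Module.finBasis ℂ E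
      have h1 : ∀ x : Rd d, l (a (∑ j ∈ insert j s, x j • EuclideanSpace.single j (1 : ℝ)) v) =
          ∑ k, β.coord k (a (∑ j ∈ s, x j • EuclideanSpace.single j (1 : ℝ)) v) *
            l (a (x j • EuclideanSpace.single j (1 : ℝ)) (β k)) := fun x => by
        rw [Finset.sum_insert hj, hadd, mul_apply_eq_comp]
        conv_lhs => rw [← β.sum_repr (a (∑ j ∈ s, x j • EuclideanSpace.single j (1 : ℝ)) v)]
        simp only [map_sum, map_smul, smul_eq_mul, Module.Basis.coord_apply]
      simp_rw [h1]
      refine .sum _ fun k _ => (ih (β.coord k)).mul ?_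
      refine isExpPoly_of_one_parameter_group
        (b := fun t : ℝ => a (t • EuclideanSpace.single j (1 : ℝ))) (ha.comp (by fun_prop))
        (by simpa using h0) (fun s t => ?_) l (β k) j
      rw [add_smul, hadd]
  have h2 : ∀ x : Rd d, ∑ j, x j • EuclideanSpace.single j (1 : ℝ) = x := fun x => by
    ext i
    simp [Finset.sum_apply, Pi.single_apply]
  simpa only [h2] using key Finset.univ l

end Representation

/-! ### Finite-dimensional translation invariant spaces -/

namespace SchwartzDistrib

variable {d : ℕ}

/-- The shift operator as a complex-linear map. -/
noncomputable def tauLin (y : Rd d) : SchwartzDistrib d →ₗ[ℂ] SchwartzDistrib d where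
  toFun := tau y
  map_add' := map_add _
  map_smul' _ _ := rfl

theorem tauLin_apply (y : Rd d) (T : SchwartzDistrib d) : tauLin y T = tau y T := rfl

theorem tau_add (x y : Rd d) (T : SchwartzDistrib d) : tau (x + y) T = tau x (tau y T) := by
  ext φ
  simp only [tau_apply]
  congr 1
  ext z
  simp only [TestFun.shift_apply]
  congr 1
  abel

theorem tau_zero (T : SchwartzDistrib d) : tau 0 T = T := by
  ext φ
  rw [tau_apply]
  congr 1
  ext z
  simp

/-- Evaluation of distributions at a test function, as a complex-linear map. -/
noncomputable def evalLin (φ : TestFun d) : SchwartzDistrib d →ₗ[ℂ] ℂ where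
  toFun T := T φ
  map_add' _ _ := rfl
  map_smul' _ _ := rfl

theorem evalLin_apply (φ : TestFun d) (T : SchwartzDistrib d) : evalLin φ T = T φ := rfl

/-- A distribution lies in a finite-dimensional translation invariant space. -/
def FiniteOrbit (f : SchwartzDistrib d) : Prop :=
  ∃ V : Submodule ℂ (SchwartzDistrib d), FiniteDimensional ℂ V ∧ f ∈ V ∧
    ∀ y, ∀ T ∈ V, tau y T ∈ V

end SchwartzDistrib

/-- A continuous family of operators on `ℝ^d` which is the identity at `0` has an invertible average
against a test function. -/
theorem TestFun.exists_isUnit_integral_smul {d : ℕ} {𝔸 : Type*} [NormedRing 𝔸] [NormedAlgebra ℂ 𝔸]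
    [CompleteSpace 𝔸] {a : Rd d → 𝔸} (ha : Continuous a) (h0 : a 0 = 1) :
    ∃ ρ : TestFun d, IsUnit (∫ y, (ρ y : ℂ) • a y) := by
  let b : ℕ → ContDiffBump (0 : Rd d) := fun n =>
    ⟨1 / ((n : ℝ) + 1) / 2, 1 / ((n : ℝ) + 1), by positivity, half_lt_self (by positivity)⟩
  -- The argument of `a` is negated because the convolution at `0` evaluates its second factor at `0
  -- - y`.
  have h1 := ContDiffBump.convolution_tendsto_right_of_continuous (μ := volume) (φ := b)
    (l := atTop) tendsto_one_div_add_atTop_nhds_zero_nat (ha.comp continuous_neg) (0 : Rd d)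
  rw [Function.comp_apply, neg_zero, h0] at h1
  obtain ⟨n, hn⟩ :=
    (h1.eventually (Units.isOpen.mem_nhds (isUnit_one : IsUnit (1 : 𝔸)))).exists
  refine ⟨⟨(b n).normed volume, (b n).contDiff_normed, (b n).hasCompactSupport_normed,
    fun _ _ => trivial⟩, ?_⟩
  convert hn using 1
  change _ = ∫ y, (b n).normed volume y • a (-(0 - y))
  simp only [zero_sub, neg_neg]
  rfl

/-- Every vector is an average of an orbit: take `v` to be the preimage of `w` under an invertible
averaged operator. -/
theorem TestFun.exists_integral_apply_eq {d : ℕ} {E : Type*} [NormedAddCommGroup E]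
    [NormedSpace ℂ E] [FiniteDimensional ℂ E] {a : Rd d → E →L[ℂ] E} (ha : Continuous a)
    (h0 : a 0 = 1) (w : E) :
    ∃ (ρ : TestFun d) (v : E), ∀ l : E →ₗ[ℂ] ℂ, ∫ y, (ρ y : ℂ) * l (a y v) = l w := by
  have : CompleteSpace E := FiniteDimensional.complete ℂ E
  obtain ⟨ρ, hρ⟩ := TestFun.exists_isUnit_integral_smul ha h0
  obtain ⟨B, hB⟩ := hρ.exists_right_inv
  have hint : Integrable fun y => (ρ y : ℂ) • a y := by
    refine Continuous.integrable_of_hasCompactSupport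
      ((Complex.continuous_ofReal.comp ρ.continuous).smul ha) ?_
    exact (ρ.hasCompactSupport.comp_left Complex.ofReal_zero).smul_right
  refine ⟨ρ, B w, fun l => ?_⟩
  have h1 := ((LinearMap.toContinuousLinearMap l) ∘L
    (ContinuousLinearMap.apply ℂ E (B w))).integral_comp_comm hint
  have h2 : (∫ y, (ρ y : ℂ) • a y) (B w) = w := by
    rw [← mul_apply_eq_comp, hB, one_apply_eq_self]
  refine Eq.trans (integral_congr_ae (ae_of_all _ fun y => ?_)) (h1.trans (congrArg l h2))
  change _ = l (((ρ y : ℂ) • a y) (B w))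
  rw [smul_apply, map_smul, smul_eq_mul]

namespace SchwartzDistrib

variable {d : ℕ}

/-- The translations act on a finite-dimensional translation invariant space of distributions by a
continuous representation. -/
theorem FiniteOrbit.exists_representation {f : SchwartzDistrib d} (hf : FiniteOrbit f) :
    ∃ (n : ℕ) (a : Rd d → (Fin n → ℂ) →L[ℂ] (Fin n → ℂ)) (S : (Fin n → ℂ) → SchwartzDistrib d)
      (ℓ : TestFun d → (Fin n → ℂ) →ₗ[ℂ] ℂ),
      Continuous a ∧ a 0 = 1 ∧ (∀ x y, a (x + y) = a x * a y) ∧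
      (∀ φ y v, ℓ φ (a y v) = tau y (S v) φ) ∧ ∃ v, ∀ φ, ℓ φ v = f φ := by
  obtain ⟨V, hV, hfV, hinv⟩ := hf
  obtain ⟨n, ⟨β⟩⟩ : ∃ n, Nonempty (Module.Basis (Fin n) ℂ V) := ⟨_, ⟨Module.finBasis ℂ V⟩⟩
  obtain ⟨e, -⟩ : ∃ e : V ≃ₗ[ℂ] (Fin n → ℂ), e = β.equivFun := ⟨_, rfl⟩
  let a : Rd d → (Fin n → ℂ) →L[ℂ] (Fin n → ℂ) := fun y =>
    LinearMap.toContinuousLinearMap (e.conj ((tauLin y).restrict (hinv y)))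
  let ℓ : TestFun d → (Fin n → ℂ) →ₗ[ℂ] ℂ := fun φ =>
    evalLin φ ∘ₗ V.subtype ∘ₗ e.symm.toLinearMap
  have ha : ∀ y v, (e.symm (a y v) : SchwartzDistrib d) = tau y (e.symm v : SchwartzDistrib d) :=
    fun y v => by
      simp only [a, LinearMap.coe_toContinuousLinearMap', LinearEquiv.conj_apply_apply,
        LinearEquiv.symm_apply_apply]
      rfl
  have hℓ : ∀ φ y v, ℓ φ (a y v) = tau y (e.symm v : SchwartzDistrib d) φ := fun φ y v => by
    rw [← ha]; rfl
  -- Test functions separate distributions, so in finite dimension their evaluations span the dual;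
  -- weak continuity of `a` thus gives norm continuity.
  have hspan : Submodule.span ℂ (range ℓ) = ⊤ := by
    refine Submodule.span_eq_top_of_ne_zero fun v hv => ?_
    by_contra! h
    refine hv (e.symm.map_eq_zero_iff.1 (Subtype.ext ?_))
    ext φ
    exact h (ℓ φ) ⟨φ, rfl⟩
  have hcl : ∀ (l : (Fin n → ℂ) →ₗ[ℂ] ℂ) (v : Fin n → ℂ), Continuous fun y => l (a y v) := by
    intro l v
    have hl : l ∈ Submodule.span ℂ (range ℓ) := hspan ▸ Submodule.mem_top
    induction hl using Submodule.span_induction with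
    | mem l hl =>
      obtain ⟨φ, rfl⟩ := hl
      simp_rw [hℓ]
      exact continuous_tau_apply _ _
    | zero => exact continuous_const
    | add l₁ l₂ _ _ h₁ h₂ => exact h₁.add h₂
    | smul c l _ h => exact h.const_smul c
  have hinj : ∀ v w : Fin n → ℂ, (e.symm v : SchwartzDistrib d) = e.symm w → v = w :=
    fun v w h => e.symm.injective (Subtype.ext h)
  refine ⟨n, a, fun v => e.symm v, ℓ, ?_, ?_, ?_, hℓ, e ⟨f, hfV⟩, fun φ => ?_⟩
  · exact continuous_clm_apply.2 fun v => continuous_pi fun i => hcl (LinearMap.proj i) v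
  · ext1 v
    exact hinj _ _ (by rw [ha, tau_zero]; rfl)
  · intro x y
    ext1 v
    exact hinj _ _ (by rw [ha, tau_add, mul_apply_eq_comp, ha, ha])
  · simp [ℓ, evalLin_apply]

/-- **Anselone–Korevaar theorem**: the elements of a finite-dimensional translation invariant space
of distributions are continuous exponential polynomials. -/
theorem FiniteOrbit.isContinuousExpPoly {f : SchwartzDistrib d} (hf : FiniteOrbit f) :
    f.IsContinuousExpPoly := by
  obtain ⟨n, a, S, ℓ, hac, ha0, hadd, hℓ, w, hw⟩ := hf.exists_representation
  obtain ⟨ρ, v, hv⟩ := TestFun.exists_integral_apply_eq hac ha0 w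
  have hexp : IsExpPoly fun y => ℓ ρ (a y v) := isExpPoly_of_representation hac ha0 hadd _ _
  refine ⟨fun y => ℓ ρ (a y v), hexp.continuous, hexp, fun φ => ?_⟩
  -- Now `f φ` is the average of `⟨τ_y (S v), φ⟩` against `ρ`.
  rw [← hw, ← hv]
  simp only [hℓ]
  exact integral_tau_comm _ _ _

end SchwartzDistrib

/-! ### From differences to the distribution itself -/

/-- A closed additive subgroup of `ℝ^d` that contains the standard basis and its multiple by `√2` is
everything. -/
theorem EuclideanSpace.addSubgroup_eq_top_of_isClosed {d : ℕ} (G : AddSubgroup (Rd d))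
    (hG : IsClosed (G : Set (Rd d))) (h1 : ∀ j, EuclideanSpace.single j (1 : ℝ) ∈ G)
    (h2 : ∀ j, (√2 : ℝ) • EuclideanSpace.single j (1 : ℝ) ∈ G) : G = ⊤ := by
  have hline : ∀ (j : Fin d) (t : ℝ), t • EuclideanSpace.single j (1 : ℝ) ∈ G := fun j => by
    let φ : ℝ →+ Rd d := (LinearMap.toSpanSingleton ℝ (Rd d) (EuclideanSpace.single j 1)).toAddMonoidHom
    have hφ : Continuous φ := by
      change Continuous fun t : ℝ => t • EuclideanSpace.single j (1 : ℝ)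
      fun_prop
    have hle : AddSubgroup.closure {√2, 1} ≤ G.comap φ := by
      rw [AddSubgroup.closure_le]
      rintro t (rfl | rfl)
      · exact h2 j
      · change (1 : ℝ) • _ ∈ G
        rw [one_smul]
        exact h1 j
    have hd : Dense (AddSubgroup.closure {√2, (1 : ℝ)} : Set ℝ) :=
      dense_addSubgroupClosure_pair_iff.2 (by simpa using irrational_sqrt_two)
    have hcl : IsClosed (G.comap φ : Set ℝ) := hG.preimage hφ
    intro t
    have : t ∈ closure (G.comap φ : Set ℝ) := (hd.mono hle).closure_eq ▸ mem_univ t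
    rwa [hcl.closure_eq] at this
  refine eq_top_iff.2 fun x _ => ?_
  have h3 : ∑ j, x j • EuclideanSpace.single j (1 : ℝ) = x := by
    ext i
    simp [Finset.sum_apply, Pi.single_apply]
  rw [← h3]
  exact sum_mem fun j _ => hline j _

namespace SchwartzDistrib

variable {d : ℕ}

/-- Embedded in `TestFun d → ℂ` with pointwise convergence, `V` is closed because it is
finite-dimensional, and `y ↦ τ_y T` is continuous there. -/
theorem isClosed_setOf_tau_mem (V : Submodule ℂ (SchwartzDistrib d)) [FiniteDimensional ℂ V]
    (T : SchwartzDistrib d) : IsClosed {y : Rd d | tau y T ∈ V} := by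
  let ι : SchwartzDistrib d →ₗ[ℂ] (TestFun d → ℂ) := LinearMap.pi evalLin
  have hι : Function.Injective ι := fun S T h => by
    ext φ
    exact congrFun h φ
  have hcl : IsClosed (V.map ι : Set (TestFun d → ℂ)) := Submodule.closed_of_finiteDimensional _
  have hcont : Continuous fun y => ι (tau y T) := continuous_pi fun φ => continuous_tau_apply T φ
  convert hcl.preimage hcont using 1
  ext y
  exact hι.mem_set_image.symm

/-- If all differences of a distribution lie in finite-dimensional translation invariant spaces,
then so does the distribution. -/
theorem FiniteOrbit.of_forall_sub {f : SchwartzDistrib d} (h : ∀ y, FiniteOrbit (tau y f - f)) :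
    FiniteOrbit f := by
  choose U hUfin hUmem hUinv using h
  -- Only these `2d` shifts are used, which keeps the sum of the spaces `U` finite-dimensional.
  let g : Fin d × Bool → Rd d := fun p =>
    (if p.2 then √2 else (1 : ℝ)) • EuclideanSpace.single p.1 (1 : ℝ)
  let V₀ : Submodule ℂ (SchwartzDistrib d) := ⨆ p, U (g p)
  have hV₀ : ∀ y, ∀ T ∈ V₀, tau y T ∈ V₀ := fun y => by
    have : V₀ ≤ V₀.comap (tauLin y) := iSup_le fun p T hT =>
      Submodule.mem_iSup_of_mem p (hUinv _ y T hT)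
    exact this
  let V : Submodule ℂ (SchwartzDistrib d) := V₀ ⊔ Submodule.span ℂ {f}
  have hVfin : FiniteDimensional ℂ V := inferInstance
  have hfV : f ∈ V := Submodule.mem_sup_right (Submodule.mem_span_singleton_self f)
  have hV : ∀ y, tau y f ∈ V → ∀ T ∈ V, tau y T ∈ V := fun y hy => by
    have : V ≤ V.comap (tauLin y) := sup_le (fun T hT => Submodule.mem_sup_left (hV₀ y T hT))
      ((Submodule.span_singleton_le_iff_mem _ _).2 hy)
    exact this
  -- Both signs are imposed so that `G` is closed under negation; closure under addition holds as
  -- `tau y f ∈ V` already makes `V` stable under `tau y`.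
  let G : AddSubgroup (Rd d) :=
    { carrier := {y | tau y f ∈ V} ∩ {y | tau (-y) f ∈ V}
      add_mem' := fun {x y} hx hy => by
        refine ⟨?_, ?_⟩
        · change tau (x + y) f ∈ V
          rw [tau_add]
          exact hV x hx.1 _ hy.1
        · change tau (-(x + y)) f ∈ V
          rw [neg_add, tau_add]
          exact hV _ hx.2 _ hy.2
      zero_mem' := by simp [tau_zero, hfV]
      neg_mem' := fun {x} hx => ⟨hx.2, by simpa using hx.1⟩ }
  have hG : IsClosed (G : Set (Rd d)) := (isClosed_setOf_tau_mem V f).inter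
    ((isClosed_setOf_tau_mem V f).preimage continuous_neg)
  have hgen : ∀ p, g p ∈ G := fun p => by
    have h1 : tau (g p) f - f ∈ V₀ := Submodule.mem_iSup_of_mem p (hUmem _)
    have h2 : tau (g p) f = (tau (g p) f - f) + f := by abel
    have h3 : tau (-g p) f = f - tau (-g p) (tau (g p) f - f) := by
      rw [map_sub, ← tau_add, neg_add_cancel, tau_zero]
      abel
    refine ⟨?_, ?_⟩
    · change tau (g p) f ∈ V
      rw [h2]
      exact add_mem (Submodule.mem_sup_left h1) hfV
    · change tau (-g p) f ∈ V
      rw [h3]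
      exact sub_mem hfV (Submodule.mem_sup_left (hV₀ _ _ h1))
  have htop : G = ⊤ := EuclideanSpace.addSubgroup_eq_top_of_isClosed G hG
    (fun j => by simpa [g] using hgen (j, false)) (fun j => by simpa [g] using hgen (j, true))
  refine ⟨V, hVfin, hfV, fun y => hV y ?_⟩
  have : y ∈ G := htop ▸ AddSubgroup.mem_top y
  exact this.1

/-! ### Elimination of terms -/

theorem finiteOrbit_of_forall_tau_mem {f : SchwartzDistrib d} (W : Submodule ℂ (SchwartzDistrib d))
    [FiniteDimensional ℂ W] (h : ∀ y, tau y f ∈ W) : FiniteOrbit f := by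
  have hle : Submodule.span ℂ (range fun y => tau y f) ≤ W :=
    Submodule.span_le.2 (range_subset_iff.2 h)
  refine ⟨Submodule.span ℂ (range fun y => tau y f), Submodule.finiteDimensional_of_le hle,
    Submodule.subset_span ⟨0, tau_zero f⟩, fun y => ?_⟩
  have : Submodule.span ℂ (range fun y => tau y f) ≤
      (Submodule.span ℂ (range fun y => tau y f)).comap (tauLin y) := by
    rw [Submodule.span_le]
    rintro _ ⟨z, rfl⟩
    exact Submodule.subset_span ⟨y + z, tau_add y z f⟩
  exact this

theorem _root_.Matrix.exists_toEuclideanLin_eq {A : Matrix (Fin d) (Fin d) ℝ} (hA : IsUnit A)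
    (y : Rd d) : ∃ x, Matrix.toEuclideanLin A x = y := by
  obtain ⟨B, hB⟩ := hA.exists_right_inv
  refine ⟨Matrix.toEuclideanLin B y, ?_⟩
  ext i
  simp [Matrix.toLpLin_apply, hB]

theorem finiteOrbit_of_sum_tau_mem {ι : Type*} [DecidableEq ι]
    {c : ι → Matrix (Fin d) (Fin d) ℝ} (hc : ∀ i, IsUnit (c i))
    (hcc : ∀ i j, i ≠ j → IsUnit (c i - c j)) (s : Finset ι) (f : ι → SchwartzDistrib d)
    (W : Submodule ℂ (SchwartzDistrib d)) [FiniteDimensional ℂ W]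
    (hf : ∀ y : Rd d, ∑ i ∈ s, tau (Matrix.toEuclideanLin (c i) y) (f i) ∈ W) :
    ∀ i ∈ s, FiniteOrbit (f i) := by
  induction hn : s.card generalizing s f W with
  | zero => simp [Finset.card_eq_zero.1 hn]
  | succ n ih =>
    intro i hi
    by_cases hk : ∃ k ∈ s, k ≠ i
    · obtain ⟨k, hk, hki⟩ := hk
      refine .of_forall_sub fun y => ?_
      obtain ⟨h, rfl⟩ := Matrix.exists_toEuclideanLin_eq (hcc i k hki.symm) y
      have hcard : (s.erase k).card = n := by
        rw [Finset.card_erase_of_mem hk, hn, Nat.add_sub_cancel]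
      -- `h` stays fixed while `y` varies, so enlarging `W` by one translate suffices.
      refine ih (s.erase k)
        (fun j => tau (Matrix.toEuclideanLin (c j - c k) h) (f j) - f j)
        (W.map (tauLin (-Matrix.toEuclideanLin (c k) h)) ⊔ W) (fun y => ?_) hcard i
        (Finset.mem_erase.2 ⟨hki.symm, hi⟩)
      have h1 : ∑ j ∈ s.erase k, tau (Matrix.toEuclideanLin (c j) y)
          (tau (Matrix.toEuclideanLin (c j - c k) h) (f j) - f j) =
          tauLin (-Matrix.toEuclideanLin (c k) h)
            (∑ j ∈ s, tau (Matrix.toEuclideanLin (c j) (y + h)) (f j)) -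
          ∑ j ∈ s, tau (Matrix.toEuclideanLin (c j) y) (f j) := by
        rw [map_sum, ← Finset.sum_sub_distrib, ← Finset.sum_erase_add _ _ hk]
        have h2 : ∀ j, tauLin (-Matrix.toEuclideanLin (c k) h)
            (tau (Matrix.toEuclideanLin (c j) (y + h)) (f j)) =
            tau (Matrix.toEuclideanLin (c j) y) (tau (Matrix.toEuclideanLin (c j - c k) h) (f j)) :=
          fun j => by
            rw [tauLin_apply, ← tau_add, ← tau_add, map_add, map_sub, LinearMap.sub_apply]
            congr 2
            abel
        simp only [h2, map_sub, sub_self, LinearMap.zero_apply, map_zero, tau_zero, add_zero]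
      rw [h1]
      exact sub_mem (Submodule.mem_sup_left (Submodule.mem_map_of_mem (hf _)))
        (Submodule.mem_sup_right (hf _))
    · push Not at hk
      -- With one term left, surjectivity of `c i` puts every translate of `f i` in `W`.
      have hs : s = {i} := Finset.eq_singleton_iff_unique_mem.2 ⟨hi, hk⟩
      refine finiteOrbit_of_forall_tau_mem W fun y => ?_
      obtain ⟨x, rfl⟩ := Matrix.exists_toEuclideanLin_eq (hc i) y
      simpa [hs] using hf x

end SchwartzDistrib

theorem mainTheorem4 (d m : ℕ) (f : Fin m → SchwartzDistrib d)
    (c : Fin m → Matrix (Fin d) (Fin d) ℝ)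
    (W : Submodule ℂ (SchwartzDistrib d)) (hW : FiniteDimensional ℂ W)
    (hf : ∀ y : Rd d, ∑ i, SchwartzDistrib.tau (Matrix.toEuclideanLin (c i) y) (f i) ∈ W)
    (hc : ∀ i, IsUnit (c i))
    (hcc : ∀ i j, i ≠ j → IsUnit (c i - c j)) :
    ∀ i, (f i).IsContinuousExpPoly := fun i =>
  (SchwartzDistrib.finiteOrbit_of_sum_tau_mem hc hcc Finset.univ f W hf i
    (Finset.mem_univ i)).isContinuousExpPoly
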